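/- Let $X,Y,Z$ be real Banach spaces with $X$ and $Y$ separable, let $U\subset X$ and $V\subset Y$ be open sets, let $k\ge 1$ be an integer, let $\Phi:U\times V\to Z$ be a map of class $\mathcal{C}^k$, and let $z\in Z$. Assume that for every $(x,y)\in U\times V$ with $\Phi(x,y)=z$: (i) the partial differential $D_x\Phi(x,y):X\to Z$ is a Fredholm operator (closed image of finite codimension, finite-dimensional kernel) of index $\dim \ker D_x\Phi(x,y)-\operatorname{codim}\operatorname{im} D_x\Phi(x,y)$ strictly less than $k$; (ii) the full differential $D\Phi(x,y):X\times Y\to Z$ is surjective. Let $\Theta$ be the set of $y\in V$ such that $z$ is a regular value of $\Phi(\cdot,y):U\to Z$, i.e. $D_x\Phi(x,y)$ is surjective for every $x\in U$ with $\Phi(x,y)=z$. Then $\Theta$ is generic and prevalent in $V$. Here a subset $G\subset V$ is generic in $V$ if it contains a countable intersection of dense open subsets of $V$. It is prevalent in $V$ if $V\setminus G$ is Haar-null in $Y$, that is, $V\setminus G$ is contained in a Borel set $B\subset Y$ for which there is a nonzero finite Borel measure $\mu$ on $Y$ with compact support such that $\mu(y+B)=0$ for all $y\in Y$. -/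

import Mathlib

open Set MeasureTheory

/-- `G` is generic in the open set `U`: `G` is a subset of `U` which contains a countable
intersection of dense open subsets of `U`. -/
def IsGenericIn {E : Type*} [TopologicalSpace E] (U G : Set E) : Prop :=
  G ⊆ U ∧ ∃ O : ℕ → Set E,
    (∀ n, IsOpen (O n) ∧ O n ⊆ U ∧ U ⊆ closure (O n)) ∧ (⋂ n, O n) ⊆ G

/-- `s` is Haar-null: it is contained in a Borel set `B` all of whose translates `x + B` are null
for some nonzero finite Borel measure `μ` which is carried by a compact set. -/
def IsHaarNull {E : Type*} [NormedAddCommGroup E] [MeasurableSpace E] [BorelSpace E]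
    (s : Set E) : Prop :=
  ∃ B : Set E, s ⊆ B ∧ MeasurableSet B ∧
    ∃ μ : Measure E, IsFiniteMeasure μ ∧ μ ≠ 0 ∧ (∃ K : Set E, IsCompact K ∧ μ Kᶜ = 0) ∧
      ∀ x : E, μ ((fun b => x + b) '' B) = 0

/-- `G` is prevalent in the open set `U`: `G` is a subset of `U` and `U \ G` is Haar-null. -/
def IsPrevalentIn {E : Type*} [NormedAddCommGroup E] [MeasurableSpace E] [BorelSpace E]
    (U G : Set E) : Prop :=
  G ⊆ U ∧ IsHaarNull (U \ G)

/-- The Fredholm index `dim (ker L) - codim (im L)`, meaningful when `L` is Fredholm. -/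
noncomputable def fredholmIndex {E F : Type*} [NormedAddCommGroup E] [NormedSpace ℝ E]
    [NormedAddCommGroup F] [NormedSpace ℝ F] (L : E →L[ℝ] F) : ℤ :=
  (Module.finrank ℝ L.ker : ℤ) - (Module.finrank ℝ (F ⧸ L.range) : ℤ)

/-- `z` is a regular value of the map `f`, considered on the open set `U`: the differential of `f`
is surjective at every point of `U` where `f` takes the value `z`. -/
def IsRegularValueOn {E F : Type*} [NormedAddCommGroup E] [NormedSpace ℝ E]
    [NormedAddCommGroup F] [NormedSpace ℝ F] (f : E → F) (U : Set E) (z : F) : Prop :=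
  ∀ x ∈ U, f x = z → Function.Surjective (fderiv ℝ f x)

/-!
The critical parameters, i.e. the `y ∈ V` for which `z` is not a regular value of `Φ (·, y)`, are
covered by countably many closed sets `B`, each of which is *null along finitely many directions*:
its trace on every translate of some finite-dimensional subspace is Lebesgue null
(`exists_countable_cover_of_critical_parameters`). This yields both conclusions. A closed set of
this kind has empty interior, hence genericity. For prevalence the directions are always taken in
one fixed sequence `e` with dense span and `∑ ‖eᵢ‖ < ∞`; by Fubini, the law of the random series
`∑ ωᵢ eᵢ`, with `ωᵢ` independent and uniform in `[0, 1]`, charges no translate of any set null along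
finitely many of the `eᵢ`, so that a single compactly supported measure deals with the whole
countable union (`isHaarNull_iUnion_of_isNullAlong`).

The covering is local, by Lindelöf's property, and is made separately for each codimension `q` of
the range of `D_x Φ`. At a critical solution `(x₀, y₀)` with this codimension, let `n` be the
dimension of the kernel of `D_x Φ` and choose `q` of the `eᵢ` which `D_y Φ` sends to a basis of a
complement of the range. By the implicit function theorem the equation `Φ (x, y + ∑ tⱼ eⱼ) = z` can
be solved for `(x, t)` as a `C^k` function of `(ν, y)`, where `ν ∈ ℝⁿ` is the kernel component of
`x`. The solutions with `t = 0` at which the codimension is still `q` are those where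
the differential of `t` in `ν` vanishes (`snd_fderiv_eq_zero_of_finrank_eq`). So the parameters to
be covered form a closed set, thanks to compactness in `ν`, and its trace on a translate of the span
of the `eⱼ` is locally a set of critical values *of rank zero* of the map `ν ↦ t` from `ℝⁿ` to `ℝ^q`
(`exists_isClosed_null_of_parametrization`).

It remains to prove Sard's theorem at points of rank zero, for `C^k` maps from `ℝⁿ` to `ℝ^q` with
`n ≤ k q`, which follows from `n - q < k` and `q ≥ 1`
(`volume_image_eq_zero_of_fderiv_eq_zero`). Morse's decomposition lemma
(`exists_countable_cover_isFlatPiece`) covers the critical set by countably many images of `C¹` maps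
`ψ` along which every `C^(k-1)` map vanishing on the critical set, such as the differential of `g`,
is `o(‖v - u‖ ^ (k - 1))`. Therefore `g ∘ ψ` varies by `o(‖v - u‖ ^ k)`, and a comparison of
Hausdorff measures shows that such a map has a null image.
-/

open Filter Asymptotics
open scoped Topology ENNReal NNReal

/-! ### Maps with increments `o(‖v - u‖ ^ k)` -/

/-- A map whose derivative is `o(‖v - u‖ ^ k)` near `u` has increment `o(‖v - u‖ ^ (k + 1))`. -/
theorem isLittleO_sub_of_isLittleO_fderiv {E F : Type*} [NormedAddCommGroup E] [NormedSpace ℝ E]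
    [NormedAddCommGroup F] [NormedSpace ℝ F] {h : E → F} {u : E} {k : ℕ}
    (hd : ∀ᶠ v in 𝓝 u, DifferentiableAt ℝ h v)
    (ho : (fderiv ℝ h) =o[𝓝 u] fun v => ‖v - u‖ ^ k) :
    (fun v => h v - h u) =o[𝓝 u] fun v => ‖v - u‖ ^ (k + 1) := by
  rw [isLittleO_iff] at ho ⊢
  intro ε hε
  obtain ⟨δ, hδ, hball⟩ := Metric.eventually_nhds_iff_ball.1 (hd.and (ho hε))
  filter_upwards [Metric.ball_mem_nhds u hδ] with v hv
  have hsub : Metric.closedBall u ‖v - u‖ ⊆ Metric.ball u δ :=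
    Metric.closedBall_subset_ball (by simpa [dist_eq_norm] using hv)
  have := (convex_closedBall u ‖v - u‖).norm_image_sub_le_of_norm_fderiv_le (𝕜 := ℝ)
    (f := h) (C := ε * ‖v - u‖ ^ k) (x := u) (y := v)
    (fun w hw => (hball w (hsub hw)).1) (fun w hw => ?_) (by simp) (by simp [dist_eq_norm])
  · rw [norm_pow, norm_norm, pow_succ, ← mul_assoc]
    exact this
  · refine (hball w (hsub hw)).2.trans ?_
    rw [norm_pow, norm_norm]
    gcongr
    simpa [dist_eq_norm] using hw

/-- If `fderiv g` is `o(‖v - u‖ ^ k)` along a `C¹` map `ψ`, so is the differential of `g ∘ ψ`. -/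
theorem isLittleO_fderiv_comp {E E' F : Type*} [NormedAddCommGroup E] [NormedSpace ℝ E]
    [NormedAddCommGroup E'] [NormedSpace ℝ E'] [NormedAddCommGroup F] [NormedSpace ℝ F]
    {ψ : E → E'} {g : E' → F} {u : E} {k : ℕ} (hψ : ContDiffAt ℝ 1 ψ u)
    (hg : ∀ᶠ v in 𝓝 u, DifferentiableAt ℝ g (ψ v))
    (ho : (fun v => fderiv ℝ g (ψ v)) =o[𝓝 u] fun v => ‖v - u‖ ^ k) :
    (fderiv ℝ (g ∘ ψ)) =o[𝓝 u] fun v => ‖v - u‖ ^ k := by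
  have hψd : ∀ᶠ v in 𝓝 u, DifferentiableAt ℝ ψ v :=
    (hψ.eventually (by simp)).mono fun v hv => hv.differentiableAt one_ne_zero
  have hbdd : (fderiv ℝ ψ) =O[𝓝 u] fun _ => (1 : ℝ) :=
    (hψ.continuousAt_fderiv one_ne_zero).isBigO_one ℝ
  have h1 : (fun v => ‖fderiv ℝ g (ψ v)‖ * ‖fderiv ℝ ψ v‖) =o[𝓝 u] fun v => ‖v - u‖ ^ k := by
    simpa using ho.norm_left.mul_isBigO hbdd.norm_left
  refine IsBigO.trans_isLittleO (IsBigO.of_bound 1 ?_) h1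
  filter_upwards [hψd, hg] with v h2 h3
  rw [fderiv_comp v h3 h2, one_mul, norm_mul, norm_norm, norm_norm]
  exact ContinuousLinearMap.opNorm_comp_le _ _

theorem exists_countable_measurable_partition (m : ℕ) {δ : ℝ} (hδ : 0 < δ) :
    ∃ P : ℕ → Set (Fin m → ℝ), (∀ i, MeasurableSet (P i)) ∧ Pairwise (Function.onFun Disjoint P) ∧
      (⋃ i, P i) = univ ∧ ∀ i, ∀ u ∈ P i, ∀ v ∈ P i, dist u v < δ := by
  obtain ⟨x, hx⟩ := TopologicalSpace.exists_dense_seq (Fin m → ℝ)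
  refine ⟨disjointed fun i => Metric.ball (x i) (δ / 2), fun i => ?_, disjoint_disjointed _, ?_, ?_⟩
  · exact MeasurableSet.disjointed (fun i => Metric.isOpen_ball.measurableSet) i
  · rw [iUnion_disjointed]
    refine eq_univ_of_forall fun y => ?_
    obtain ⟨i, hi⟩ := hx.exists_dist_lt y (half_pos hδ)
    exact mem_iUnion.2 ⟨i, hi⟩
  · intro i u hu v hv
    have h1 := disjointed_subset _ _ hu
    have h2 := disjointed_subset _ _ hv
    simp only [Metric.mem_ball] at h1 h2
    linarith [dist_triangle_right u v (x i)]

/-- The quantitative estimate behind `volume_image_eq_zero_of_isLittleO`, on the part of a set on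
which the `o` is realised uniformly: there the map is locally `K`-Hölder with constant `ε`. -/
theorem hausdorffMeasure_image_le_of_locally_holder {m q K : ℕ} (hK : 0 < K)
    {h : (Fin m → ℝ) → (Fin q → ℝ)} {S Q : Set (Fin m → ℝ)} (hSQ : S ⊆ Q)
    (hQ : MeasurableSet Q) {ε : ℝ≥0} {δ : ℝ} (hδ : 0 < δ)
    (hh : ∀ u ∈ S, ∀ v ∈ S, dist v u < δ → ‖h v - h u‖ ≤ ε * ‖v - u‖ ^ K) :
    μH[(q : ℝ)] (h '' S) ≤ (ε : ℝ≥0∞) ^ (q : ℝ) * μH[(K : ℝ) * q] Q := by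
  obtain ⟨P, hPm, hPd, hPu, hPδ⟩ := exists_countable_measurable_partition m hδ
  have hcov : h '' S ⊆ ⋃ i, h '' (S ∩ P i) := by
    rw [← image_iUnion, ← inter_iUnion, hPu, inter_univ]
  calc μH[(q : ℝ)] (h '' S) ≤ ∑' i, μH[(q : ℝ)] (h '' (S ∩ P i)) :=
        (measure_mono hcov).trans (measure_iUnion_le _)
    _ ≤ ∑' i, (ε : ℝ≥0∞) ^ (q : ℝ) * μH[(K : ℝ) * q] (Q ∩ P i) := by
        refine ENNReal.tsum_le_tsum fun i => ?_
        have hol : HolderOnWith ε (K : ℝ≥0) h (S ∩ P i) := by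
          intro u hu v hv
          have := hh v hv.1 u hu.1 (hPδ i u hu.2 v hv.2)
          rw [edist_dist, edist_dist, dist_eq_norm, dist_eq_norm]
          rw [NNReal.coe_natCast, ENNReal.rpow_natCast, ← ENNReal.ofReal_pow (norm_nonneg _),
            ← ENNReal.ofReal_coe_nnreal, ← ENNReal.ofReal_mul ε.coe_nonneg]
          exact ENNReal.ofReal_le_ofReal this
        refine (hol.hausdorffMeasure_image_le (by exact_mod_cast hK) (Nat.cast_nonneg q)).trans ?_
        rw [NNReal.coe_natCast]
        gcongr
    _ = (ε : ℝ≥0∞) ^ (q : ℝ) * μH[(K : ℝ) * q] Q := by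
        rw [ENNReal.tsum_mul_left, ← measure_iUnion
          (fun i j hij => (hPd hij).mono inter_subset_right inter_subset_right)
          (fun i => hQ.inter (hPm i)), ← inter_iUnion, hPu, inter_univ]

theorem hausdorffMeasure_closedBall_ne_top {m : ℕ} {d : ℝ} (hd : (m : ℝ) ≤ d) (R : ℝ) :
    μH[d] (Metric.closedBall (0 : Fin m → ℝ) R) ≠ ∞ := by
  refine ne_top_of_le_ne_top ?_ (Measure.hausdorffMeasure_mono hd _)
  have := hausdorffMeasure_pi_real (ι := Fin m)
  rw [Fintype.card_fin] at this
  rw [this]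
  exact (isCompact_closedBall _ _).measure_ne_top

/-- If `h : ℝᵐ → ℝ^q` satisfies `h v - h u = o(‖v - u‖ ^ K)` at every point `u` of `S`, with
`m ≤ K * q`, then `h '' S` is Lebesgue null. -/
theorem volume_image_eq_zero_of_isLittleO {m q K : ℕ} (hK : 0 < K) (hq : 0 < q) (hm : m ≤ K * q)
    {h : (Fin m → ℝ) → (Fin q → ℝ)} {S : Set (Fin m → ℝ)}
    (ho : ∀ u ∈ S, (fun v => h v - h u) =o[𝓝 u] fun v => ‖v - u‖ ^ K) :
    volume (h '' S) = 0 := by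
  have hvol : (volume : Measure (Fin q → ℝ)) = μH[(q : ℝ)] := by
    have := hausdorffMeasure_pi_real (ι := Fin q)
    rw [Fintype.card_fin] at this
    exact this.symm
  have hcov : h '' S ⊆ ⋃ R : ℕ, h '' (S ∩ Metric.closedBall 0 R) := by
    rw [← image_iUnion, ← inter_iUnion, Metric.iUnion_closedBall_nat, inter_univ]
  refine measure_mono_null hcov (measure_iUnion_null fun R => ?_)
  set Q := Metric.closedBall (0 : Fin m → ℝ) R
  have hQtop : μH[(K : ℝ) * q] Q ≠ ∞ :=
    hausdorffMeasure_closedBall_ne_top (by exact_mod_cast hm) R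
  have key : ∀ ε : ℝ≥0, 0 < ε →
      volume (h '' (S ∩ Q)) ≤ (ε : ℝ≥0∞) ^ (q : ℝ) * μH[(K : ℝ) * q] Q := by
    intro ε hε
    -- the part of `S` on which the `o` holds with constant `ε` at scale `1 / (j + 1)`
    let T : ℕ → Set (Fin m → ℝ) := fun j =>
      {u ∈ S ∩ Q | ∀ v, dist v u < 1 / ((j : ℝ) + 1) → ‖h v - h u‖ ≤ ε * ‖v - u‖ ^ K}
    have hmono : Monotone T := by
      intro i j hij u hu
      refine ⟨hu.1, fun v hv => hu.2 v (hv.trans_le ?_)⟩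
      exact one_div_le_one_div_of_le (by positivity) (by simpa using hij)
    have hun : S ∩ Q ⊆ ⋃ j, T j := by
      intro u hu
      obtain ⟨δ, hδ, hb⟩ := Metric.eventually_nhds_iff_ball.1
        ((isLittleO_iff.1 (ho u hu.1)) (c := (ε : ℝ)) (by exact_mod_cast hε))
      obtain ⟨j, hj⟩ := exists_nat_one_div_lt hδ
      refine mem_iUnion.2 ⟨j, hu, fun v hv => ?_⟩
      simpa using hb v (Metric.mem_ball.2 (hv.trans hj))
    calc volume (h '' (S ∩ Q)) ≤ volume (⋃ j, h '' T j) := by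
          rw [← image_iUnion]; exact measure_mono (image_mono hun)
      _ = ⨆ j, volume (h '' T j) :=
          Directed.measure_iUnion
            (Monotone.directed_le fun i j hij => image_mono (hmono hij))
      _ ≤ _ := iSup_le fun j => by
          rw [hvol]
          exact hausdorffMeasure_image_le_of_locally_holder hK (fun u hu => hu.1.2)
            Metric.isClosed_closedBall.measurableSet (δ := 1 / ((j : ℝ) + 1)) (by positivity)
            (fun u hu v _ hv => hu.2 v hv)
  -- let the constant tend to zero
  have hlim : Tendsto (fun ε : ℝ≥0 => (ε : ℝ≥0∞) ^ (q : ℝ) * μH[(K : ℝ) * q] Q)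
      (𝓝[>] 0) (𝓝 0) := by
    have h1 : Tendsto (fun ε : ℝ≥0 => (ε : ℝ≥0∞) ^ (q : ℝ)) (𝓝[>] 0) (𝓝 0) := by
      have hc : Continuous fun ε : ℝ≥0 => (ε : ℝ≥0∞) ^ (q : ℝ) :=
        ENNReal.continuous_rpow_const.comp ENNReal.continuous_coe
      have := (hc.tendsto 0).mono_left (nhdsWithin_le_nhds (s := Ioi 0))
      simpa [hq.ne'] using this
    simpa using ENNReal.Tendsto.mul_const h1 (Or.inr hQtop)
  exact le_antisymm (ge_of_tendsto hlim (eventually_mem_nhdsWithin.mono fun ε hε => key ε hε))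
    zero_le

/-! ### Morse's decomposition lemma -/

/-- Near a point where a `C^k` function has nonzero differential, its level set is the image of a
`C^k` parametrization by a space of one dimension less. -/
theorem exists_parametrization_of_fderiv_ne_zero {n k : ℕ} (hk : k ≠ 0)
    {g : (Fin (n + 1) → ℝ) → ℝ} {a : Fin (n + 1) → ℝ} (hg : ContDiffAt ℝ k g a)
    (hg' : fderiv ℝ g a ≠ 0) :
    ∃ φ : (Fin n → ℝ) → (Fin (n + 1) → ℝ),
      ∀ᶠ x in 𝓝 a, g x = g a → ∃ u, ContDiffAt ℝ k φ u ∧ φ u = x := by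
  have hk' : (k : WithTop ℕ∞) ≠ 0 := by exact_mod_cast hk
  have hsurj : Function.Surjective (fderiv ℝ g a) :=
    LinearMap.surjective (f := (fderiv ℝ g a).toLinearMap)
      (fun h => hg' (ContinuousLinearMap.coe_injective h))
  have hrange : (fderiv ℝ g a).range = ⊤ := LinearMap.range_eq_top.2 hsurj
  have hker : (fderiv ℝ g a).ker.ClosedComplemented :=
    Submodule.ClosedComplemented.of_finiteDimensional _
  have hfin : Module.finrank ℝ (fderiv ℝ g a).ker = n := by
    have := LinearMap.finrank_range_add_finrank_ker (fderiv ℝ g a).toLinearMap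
    rw [hrange] at this
    simp at this
    omega
  let D := HasStrictFDerivAt.implicitFunctionDataOfComplemented g _
    (hg.hasStrictFDerivAt hk') hrange hker
  let e : (Fin n → ℝ) ≃L[ℝ] (fderiv ℝ g a).ker :=
    ContinuousLinearEquiv.ofFinrankEq (by simp [hfin])
  have hr : ContDiff ℝ k D.rightFun := by
    change ContDiff ℝ k fun x => Classical.choose hker (x - a)
    fun_prop
  have hφ : ContDiffAt ℝ k (D.implicitFunction (g a)) (D.rightFun a) := by
    have h1 : ContDiffAt ℝ k D.implicitFunction.uncurry (g a, D.rightFun a) :=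
      D.contDiffAt_implicitFunction hg hr.contDiffAt hk'
    exact h1.comp (D.rightFun a) (contDiffAt_const.prodMk contDiffAt_id)
  refine ⟨fun u => D.implicitFunction (g a) (e u), ?_⟩
  have h2 : ∀ᶠ x in 𝓝 a, ContDiffAt ℝ k (D.implicitFunction (g a)) (D.rightFun x) :=
    (hr.continuous.tendsto a).eventually (hφ.eventually (by simp))
  have h3 : ∀ᶠ x in 𝓝 a, g x = g a ↔ D.implicitFunction (g a) (D.rightFun x) = x :=
    D.leftFun_eq_iff_implicitFunction
  filter_upwards [h2, h3] with x h2 h3 hx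
  refine ⟨e.symm (D.rightFun x), ?_, by simpa using h3.1 hx⟩
  refine ContDiffAt.comp (g := D.implicitFunction (g a)) _ ?_ e.contDiff.contDiffAt
  simpa using h2

/-- A set `s` is a flat piece of order `k` relative to `A` when it lies in the image, under a map
`ψ` from a space of dimension at most `n`, of a set `S` with `ψ '' S ⊆ A`, such that `ψ` is `C¹`
near the points of `S` and every `C^k` map `g` which vanishes on `A` satisfies
`g (ψ v) = o(‖v - u‖ ^ k)` as `v → u`, for every `u ∈ S`. The targets of the maps `g` range over
`Type`, which contains the iterated spaces of differentials of maps between the `ℝⁿ`. -/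
def IsFlatPiece {n : ℕ} (k : ℕ) (A s : Set (Fin n → ℝ)) : Prop :=
  ∃ m ≤ n, ∃ (ψ : (Fin m → ℝ) → (Fin n → ℝ)) (S : Set (Fin m → ℝ)), s ⊆ ψ '' S ∧
    ∀ u ∈ S, ψ u ∈ A ∧ ContDiffAt ℝ 1 ψ u ∧
      ∀ (F : Type) [NormedAddCommGroup F] [NormedSpace ℝ F] (g : (Fin n → ℝ) → F),
        (∀ a ∈ A, ContDiffAt ℝ k g a ∧ g a = 0) →
          (fun v => g (ψ v)) =o[𝓝 u] fun v => ‖v - u‖ ^ k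

theorem isFlatPiece_zero {n : ℕ} (A : Set (Fin n → ℝ)) : IsFlatPiece 0 A A := by
  refine ⟨n, le_rfl, id, A, by simp, fun u hu => ⟨hu, contDiffAt_id, fun F _ _ g hg => ?_⟩⟩
  have h := (hg u hu).1.continuousAt.tendsto
  rw [(hg u hu).2] at h
  simpa using h

/-- If the differential of every `C^(k+1)` function vanishing on `A` also vanishes on `B ⊆ A`, then
flat pieces of order `k` relative to `B` are flat of order `k + 1` relative to `A`. -/
theorem IsFlatPiece.succ {n k : ℕ} {A B s : Set (Fin n → ℝ)} (hBA : B ⊆ A)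
    (hB : ∀ b ∈ B, ∀ g : (Fin n → ℝ) → ℝ,
      (∀ a ∈ A, ContDiffAt ℝ (k + 1 : ℕ) g a ∧ g a = 0) → fderiv ℝ g b = 0)
    (hs : IsFlatPiece k B s) : IsFlatPiece (k + 1) A s := by
  obtain ⟨m, hm, ψ, S, hsS, H⟩ := hs
  refine ⟨m, hm, ψ, S, hsS, fun u hu => ⟨hBA (H u hu).1, (H u hu).2.1, fun F _ _ g hg => ?_⟩⟩
  obtain ⟨huB, hψ, hflat⟩ := H u hu
  have hk1 : ((k + 1 : ℕ) : WithTop ℕ∞) ≠ 0 := by exact_mod_cast k.succ_ne_zero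
  have hdg : ∀ b ∈ B, ContDiffAt ℝ k (fderiv ℝ g) b ∧ fderiv ℝ g b = 0 := by
    intro b hb
    have hgb := (hg b (hBA hb)).1
    refine ⟨hgb.fderiv_right (by norm_cast), ?_⟩
    ext1 v
    -- by Hahn-Banach, the scalar hypothesis `hB` controls maps with values in `F`
    refine SeparatingDual.eq_zero_of_forall_dual_eq_zero (R := ℝ) fun L => ?_
    have h0 := hB b hb (fun x => L (g x)) fun a ha =>
      ⟨L.contDiff.contDiffAt.comp a (hg a ha).1, by simp [(hg a ha).2]⟩
    have h1 : fderiv ℝ (fun x => L (g x)) b = L ∘L fderiv ℝ g b :=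
      (L.hasFDerivAt.comp b (hgb.differentiableAt hk1).hasFDerivAt).fderiv
    rw [h1] at h0
    simpa using DFunLike.congr_fun h0 v
  have hψd : ∀ᶠ v in 𝓝 u, DifferentiableAt ℝ ψ v :=
    (hψ.eventually (by simp)).mono fun v hv => hv.differentiableAt one_ne_zero
  have hgd : ∀ᶠ v in 𝓝 u, DifferentiableAt ℝ g (ψ v) :=
    hψ.continuousAt.eventually (((hg _ (hBA huB)).1.eventually (by simp)).mono fun v hv =>
      hv.differentiableAt hk1)
  have hder : (fderiv ℝ (g ∘ ψ)) =o[𝓝 u] fun v => ‖v - u‖ ^ k :=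
    isLittleO_fderiv_comp hψ hgd (hflat _ _ hdg)
  have hcd : ∀ᶠ v in 𝓝 u, DifferentiableAt ℝ (g ∘ ψ) v := by
    filter_upwards [hψd, hgd] with v h2 h3 using h3.comp v h2
  simpa [(hg _ (hBA huB)).2] using isLittleO_sub_of_isLittleO_fderiv hcd hder

/-- Flat pieces are carried along a `C^k` parametrization of a subset of `A`. -/
theorem IsFlatPiece.image {n n' k : ℕ} (hk : k ≠ 0) (hn : n ≤ n') {A : Set (Fin n' → ℝ)}
    {T s : Set (Fin n → ℝ)} {φ : (Fin n → ℝ) → (Fin n' → ℝ)}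
    (hT : ∀ u ∈ T, φ u ∈ A ∧ ContDiffAt ℝ k φ u) (hs : IsFlatPiece k T s) :
    IsFlatPiece k A (φ '' s) := by
  obtain ⟨m, hm, ψ, S, hsS, H⟩ := hs
  refine ⟨m, hm.trans hn, φ ∘ ψ, S, ?_, fun u hu => ?_⟩
  · rw [image_comp]
    exact image_mono hsS
  · obtain ⟨huT, hψ, hflat⟩ := H u hu
    have h1 : (1 : WithTop ℕ∞) ≤ k := by exact_mod_cast Nat.one_le_iff_ne_zero.2 hk
    refine ⟨(hT _ huT).1, ((hT _ huT).2.of_le h1).comp u hψ, fun F _ _ g hg => ?_⟩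
    exact hflat F (fun w => g (φ w)) fun w hw =>
      ⟨(hg _ (hT w hw).1).1.comp w (hT w hw).2, (hg _ (hT w hw).1).2⟩

/-- **Morse's decomposition lemma**: every subset `A` of `ℝⁿ` is covered by countably many pieces
which are flat of order `k` relative to `A`. -/
theorem exists_countable_cover_isFlatPiece (n k : ℕ) (A : Set (Fin n → ℝ)) :
    ∃ 𝒮 : Set (Set (Fin n → ℝ)), 𝒮.Countable ∧ A ⊆ ⋃₀ 𝒮 ∧ ∀ s ∈ 𝒮, IsFlatPiece k A s := by
  induction n using Nat.strong_induction_on generalizing k with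
  | _ n ihn =>
  induction k generalizing A with
  | zero => exact ⟨{A}, countable_singleton A, by simp, by simpa using isFlatPiece_zero A⟩
  | succ k ihk =>
    set B : Set (Fin n → ℝ) := {b ∈ A | ∀ g : (Fin n → ℝ) → ℝ,
      (∀ a ∈ A, ContDiffAt ℝ (k + 1 : ℕ) g a ∧ g a = 0) → fderiv ℝ g b = 0}
    obtain ⟨𝒮, h𝒮c, h𝒮B, h𝒮⟩ := ihk B
    -- off `B`, the set `A` lies locally in a hypersurface
    have hloc : ∀ x ∈ A \ B, ∃ 𝒯 : Set (Set (Fin n → ℝ)), 𝒯.Countable ∧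
        ⋃₀ 𝒯 ∈ 𝓝[A \ B] x ∧ ∀ s ∈ 𝒯, IsFlatPiece (k + 1) A s := by
      rintro x ⟨hxA, hxB⟩
      have hx : ∃ g : (Fin n → ℝ) → ℝ,
          (∀ a ∈ A, ContDiffAt ℝ (k + 1 : ℕ) g a ∧ g a = 0) ∧ fderiv ℝ g x ≠ 0 := by
        by_contra! hcon
        exact hxB ⟨hxA, hcon⟩
      obtain ⟨g, hg, hgx⟩ := hx
      obtain _ | n := n
      · -- in dimension zero every differential vanishes
        exact absurd (Subsingleton.elim _ _) hgx
      obtain ⟨φ, hφ⟩ := exists_parametrization_of_fderiv_ne_zero k.succ_ne_zero (hg x hxA).1 hgx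
      obtain ⟨𝒯, h𝒯c, h𝒯T, h𝒯⟩ :=
        ihn n n.lt_succ_self (k + 1) {u | φ u ∈ A ∧ ContDiffAt ℝ (k + 1 : ℕ) φ u}
      refine ⟨image φ '' 𝒯, h𝒯c.image _, ?_, ?_⟩
      · filter_upwards [nhdsWithin_le_nhds hφ, self_mem_nhdsWithin] with y hy hyA
        obtain ⟨u, hu, rfl⟩ := hy (by rw [(hg y hyA.1).2, (hg x hxA).2])
        obtain ⟨t, ht, hut⟩ := h𝒯T (show u ∈ _ from ⟨hyA.1, hu⟩)
        exact ⟨φ '' t, mem_image_of_mem _ ht, mem_image_of_mem _ hut⟩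
      · rintro _ ⟨t, ht, rfl⟩
        exact (h𝒯 t ht).image k.succ_ne_zero n.le_succ fun u hu => hu
    choose! 𝒯 h𝒯c h𝒯n h𝒯 using hloc
    obtain ⟨t, htA, htc, ht⟩ := TopologicalSpace.countable_cover_nhdsWithin h𝒯n
    refine ⟨𝒮 ∪ ⋃ x ∈ t, 𝒯 x, h𝒮c.union (htc.biUnion fun x hx => h𝒯c x (htA hx)), ?_, ?_⟩
    · intro y hy
      by_cases hyB : y ∈ B
      · obtain ⟨s, hs, hys⟩ := h𝒮B hyB
        exact ⟨s, Or.inl hs, hys⟩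
      · obtain ⟨x, hx, s, hs, hys⟩ := mem_iUnion₂.1 (ht ⟨hy, hyB⟩)
        exact ⟨s, Or.inr (mem_biUnion hx hs), hys⟩
    · rintro s (hs | hs)
      · exact (h𝒮 s hs).succ (fun b hb => hb.1) (fun b hb => hb.2)
      · obtain ⟨x, hx, hs⟩ := mem_iUnion₂.1 hs
        exact h𝒯 x (htA hx) s hs

/-! ### Sard's theorem at points of rank zero -/

/-- **Sard's theorem at points of rank zero**: if `g` is `C^k` at the points of `A ⊆ ℝⁿ`, its
differential vanishes on `A`, and `n ≤ k * q`, then `g '' A ⊆ ℝ^q` is Lebesgue null. -/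
theorem volume_image_eq_zero_of_fderiv_eq_zero {n q k : ℕ} (hk : 0 < k) (hq : 0 < q)
    (hn : n ≤ k * q) {g : (Fin n → ℝ) → (Fin q → ℝ)} {A : Set (Fin n → ℝ)}
    (hg : ∀ a ∈ A, ContDiffAt ℝ k g a ∧ fderiv ℝ g a = 0) : volume (g '' A) = 0 := by
  obtain ⟨k, rfl⟩ := Nat.exists_eq_succ_of_ne_zero hk.ne'
  have hk1 : ((k + 1 : ℕ) : WithTop ℕ∞) ≠ 0 := by exact_mod_cast k.succ_ne_zero
  obtain ⟨𝒮, h𝒮c, h𝒮A, h𝒮⟩ := exists_countable_cover_isFlatPiece n k A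
  have hcov : g '' A ⊆ ⋃ s ∈ 𝒮, g '' s := by
    rw [← image_iUnion₂, ← sUnion_eq_biUnion]
    exact image_mono h𝒮A
  refine measure_mono_null hcov ((measure_biUnion_null_iff h𝒮c).2 fun s hs => ?_)
  obtain ⟨m, hm, ψ, S, hsS, H⟩ := h𝒮 s hs
  refine measure_mono_null ((image_mono hsS).trans (image_comp g ψ S).ge) ?_
  refine volume_image_eq_zero_of_isLittleO k.succ_pos hq (hm.trans hn) fun u hu => ?_
  obtain ⟨huA, hψ, hflat⟩ := H u hu
  have hψd : ∀ᶠ v in 𝓝 u, DifferentiableAt ℝ ψ v :=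
    (hψ.eventually (by simp)).mono fun v hv => hv.differentiableAt one_ne_zero
  have hgd : ∀ᶠ v in 𝓝 u, DifferentiableAt ℝ g (ψ v) :=
    hψ.continuousAt.eventually (((hg _ huA).1.eventually (by simp)).mono fun v hv =>
      hv.differentiableAt hk1)
  refine isLittleO_sub_of_isLittleO_fderiv ?_ ?_
  · filter_upwards [hψd, hgd] with v h2 h3 using h3.comp v h2
  · refine isLittleO_fderiv_comp hψ hgd (hflat _ (fderiv ℝ g) fun a ha => ⟨?_, (hg a ha).2⟩)
    exact (hg a ha).1.fderiv_right (by norm_cast)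

/-! ### Sets which are null along finitely many directions -/

/-- `B` is null along finitely many of the vectors `e i`: for some `q` distinct indices, the trace
of `B` on each translate of the span of the corresponding vectors is Lebesgue null, in the
coordinates given by these vectors. -/
def IsNullAlong {Y : Type*} [NormedAddCommGroup Y] [NormedSpace ℝ Y] (e : ℕ → Y) (B : Set Y) :
    Prop :=
  ∃ (q : ℕ) (σ : Fin q → ℕ), Function.Injective σ ∧
    ∀ y, volume {t : Fin q → ℝ | y + ∑ j, t j • e (σ j) ∈ B} = 0

theorem IsNullAlong.empty {Y : Type*} [NormedAddCommGroup Y] [NormedSpace ℝ Y] (e : ℕ → Y) :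
    IsNullAlong e (∅ : Set Y) :=
  ⟨0, Fin.elim0, fun i => i.elim0, by simp⟩

theorem IsNullAlong.preimage_add {Y : Type*} [NormedAddCommGroup Y] [NormedSpace ℝ Y] {e : ℕ → Y}
    {B : Set Y} (hB : IsNullAlong e B) (x : Y) : IsNullAlong e ((fun y => x + y) ⁻¹' B) := by
  obtain ⟨q, σ, hσ, h⟩ := hB
  refine ⟨q, σ, hσ, fun y => ?_⟩
  simpa only [mem_preimage, add_assoc] using h (x + y)

/-- A set which is null along some directions has empty interior. -/
theorem IsNullAlong.dense_compl {Y : Type*} [NormedAddCommGroup Y] [NormedSpace ℝ Y] {e : ℕ → Y}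
    {B : Set Y} (hB : IsNullAlong e B) : Dense Bᶜ := by
  obtain ⟨q, σ, -, h⟩ := hB
  rw [← interior_eq_empty_iff_dense_compl, eq_empty_iff_forall_notMem]
  intro y hy
  have hc : Continuous fun t : Fin q → ℝ => y + ∑ j, t j • e (σ j) := by fun_prop
  refine (hc.isOpen_preimage _ isOpen_interior).measure_ne_zero volume ⟨0, by simpa using hy⟩ ?_
  exact measure_mono_null (preimage_mono interior_subset) (h y)

theorem exists_summable_dense_span (Y : Type*) [NormedAddCommGroup Y] [NormedSpace ℝ Y]
    [TopologicalSpace.SeparableSpace Y] :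
    ∃ e : ℕ → Y, Summable (fun i => ‖e i‖) ∧ Dense (Submodule.span ℝ (range e) : Set Y) := by
  obtain ⟨d, hd⟩ := TopologicalSpace.exists_dense_seq Y
  refine ⟨fun i => ((1 / 2 : ℝ) ^ i * (1 + ‖d i‖)⁻¹) • d i, ?_, ?_⟩
  · refine Summable.of_nonneg_of_le (fun i => norm_nonneg _) (fun i => ?_)
      (summable_geometric_of_lt_one (r := 1 / 2) (by norm_num) (by norm_num))
    have h1 : (0 : ℝ) < 1 + ‖d i‖ := by positivity
    rw [norm_smul, Real.norm_of_nonneg (by positivity), mul_assoc]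
    refine mul_le_of_le_one_right (by positivity) ?_
    rw [inv_mul_le_iff₀ h1]
    linarith
  · refine hd.mono (range_subset_iff.2 fun i => SetLike.mem_coe.2 ?_)
    have h1 : (1 / 2 : ℝ) ^ i * (1 + ‖d i‖)⁻¹ ≠ 0 := by positivity
    have h2 := Submodule.smul_mem (Submodule.span ℝ
      (range fun i => ((1 / 2 : ℝ) ^ i * (1 + ‖d i‖)⁻¹) • d i)) ((1 / 2 : ℝ) ^ i * (1 + ‖d i‖)⁻¹)⁻¹
      (Submodule.subset_span (mem_range_self i))
    simpa only [smul_smul, inv_mul_cancel₀ h1, one_smul] using h2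

/-! ### A random series and Haar-null sets -/

/-- The law of a sequence of independent uniform variables on the unit interval. -/
noncomputable def cubeMeasure : Measure (ℕ → unitInterval) :=
  Measure.infinitePi fun _ => volume

instance : IsProbabilityMeasure cubeMeasure := by
  unfold cubeMeasure
  infer_instance

theorem measurable_extend {q : ℕ} (σ : Fin q → ℕ) :
    Measurable fun p : (ℕ → unitInterval) × (Fin q → unitInterval) =>
      Function.extend σ p.2 p.1 := by
  classical
  refine measurable_pi_lambda _ fun i => ?_
  by_cases h : ∃ j, σ j = i
  · simp only [Function.extend_def, h, dite_true]
    fun_prop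
  · simp only [Function.extend_def, h, dite_false]
    fun_prop

/-- Resampling finitely many coordinates of a uniform sequence does not change its law. -/
theorem map_extend_cubeMeasure {q : ℕ} {σ : Fin q → ℕ} (hσ : Function.Injective σ) :
    (cubeMeasure.prod (volume : Measure (Fin q → unitInterval))).map
      (fun p => Function.extend σ p.2 p.1) = cubeMeasure := by
  classical
  refine Measure.eq_infinitePi _ fun I t ht => ?_
  rw [Measure.map_apply (measurable_extend σ)
    (MeasurableSet.pi I.countable_toSet fun i _ => ht i)]
  have hpre : (fun p : (ℕ → unitInterval) × (Fin q → unitInterval) => Function.extend σ p.2 p.1) ⁻¹'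
      (Set.pi I t) = (Set.pi (I.filter fun i => ¬ ∃ j, σ j = i) t) ×ˢ
        (Set.pi univ fun j => if σ j ∈ I then t (σ j) else univ) := by
    ext ⟨ω, s⟩
    simp only [mem_preimage, Set.mem_pi, mem_prod, Finset.coe_filter, mem_ofPred_eq, Finset.mem_coe,
      mem_univ, forall_const]
    constructor
    · intro h
      refine ⟨fun i hi => ?_, fun j => ?_⟩
      · have := h i hi.1
        rwa [Function.extend_apply' _ _ _ hi.2] at this
      · split_ifs with hj
        · simpa [hσ.extend_apply] using h _ hj
        · trivial
    · rintro ⟨h1, h2⟩ i hi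
      by_cases hij : ∃ j, σ j = i
      · obtain ⟨j, rfl⟩ := hij
        simpa [hσ.extend_apply, hi] using h2 j
      · rw [Function.extend_apply' _ _ _ hij]
        exact h1 i ⟨hi, hij⟩
  rw [hpre, Measure.prod_prod, cubeMeasure, Measure.infinitePi_pi _ fun i _ => ht i, volume_pi,
    Measure.pi_pi, ← Finset.prod_filter_not_mul_prod_filter I (fun i => ∃ j, σ j = i)]
  congr 1
  have h1 : ∀ j, (volume : Measure unitInterval) (if σ j ∈ I then t (σ j) else univ) =
      if σ j ∈ I then volume (t (σ j)) else 1 := by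
    intro j
    split_ifs <;> simp
  simp_rw [h1]
  rw [← Finset.prod_filter]
  refine Finset.prod_nbij σ ?_ hσ.injOn ?_ fun _ _ => rfl
  · intro j hj
    simpa using hj
  · intro i hi
    simp only [Finset.coe_filter, mem_ofPred_eq] at hi
    obtain ⟨hi, j, rfl⟩ := hi
    exact ⟨j, by simpa using hi, rfl⟩

/-- The random series `∑ ωᵢ eᵢ`. -/
noncomputable def cubeSeries {Y : Type*} [NormedAddCommGroup Y] [NormedSpace ℝ Y] (e : ℕ → Y)
    (ω : ℕ → unitInterval) : Y :=
  ∑' i, (ω i : ℝ) • e i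

theorem norm_unitInterval_smul_le {Y : Type*} [NormedAddCommGroup Y]
    [NormedSpace ℝ Y] (s : unitInterval) (y : Y) : ‖(s : ℝ) • y‖ ≤ ‖y‖ := by
  rw [norm_smul, Real.norm_of_nonneg s.2.1]
  exact mul_le_of_le_one_left (norm_nonneg _) s.2.2

section CubeSeries

variable {Y : Type*} [NormedAddCommGroup Y] [NormedSpace ℝ Y] [CompleteSpace Y] {e : ℕ → Y}

theorem summable_cubeSeries (he : Summable fun i => ‖e i‖) (ω : ℕ → unitInterval) :
    Summable fun i => (ω i : ℝ) • e i :=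
  Summable.of_norm_bounded he fun _ => norm_unitInterval_smul_le _ _

theorem continuous_cubeSeries (he : Summable fun i => ‖e i‖) : Continuous (cubeSeries e) :=
  continuous_tsum (fun i => by fun_prop) he fun i ω => norm_unitInterval_smul_le _ _

theorem cubeSeries_extend (he : Summable fun i => ‖e i‖) {q : ℕ} {σ : Fin q → ℕ}
    (hσ : Function.Injective σ) (s : Fin q → unitInterval) (ω : ℕ → unitInterval) :
    cubeSeries e (Function.extend σ s ω) =
      cubeSeries e (Function.extend σ 0 ω) + ∑ j, (s j : ℝ) • e (σ j) := by
  classical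
  have h1 : ∀ i, ((Function.extend σ s ω i : unitInterval) : ℝ) • e i =
      ((Function.extend σ 0 ω i : unitInterval) : ℝ) • e i +
        ∑ j, if σ j = i then (s j : ℝ) • e (σ j) else 0 := by
    intro i
    by_cases hij : ∃ j, σ j = i
    · obtain ⟨j, rfl⟩ := hij
      rw [hσ.extend_apply, hσ.extend_apply, Finset.sum_eq_single j]
      · simp
      · intro l _ hl
        simp [hσ.eq_iff, hl]
      · simp
    · rw [Function.extend_apply' _ _ _ hij, Function.extend_apply' _ _ _ hij,
        Finset.sum_eq_zero, add_zero]
      intro j _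
      rw [if_neg fun h => hij ⟨j, h⟩]
  have h2 : ∀ j, HasSum (fun i => if σ j = i then (s j : ℝ) • e (σ j) else 0)
      ((s j : ℝ) • e (σ j)) := fun j => by
    simpa [eq_comm] using hasSum_ite_eq (σ j) ((s j : ℝ) • e (σ j))
  have h3 := ((summable_cubeSeries he (Function.extend σ 0 ω)).hasSum).add
    (hasSum_sum fun j (_ : j ∈ Finset.univ) => h2 j)
  rw [cubeSeries, tsum_congr h1]
  exact h3.tsum_eq

/-- The uniform law on `[0, 1]^q` is absolutely continuous with respect to Lebesgue measure. -/
theorem volume_preimage_coe_unitInterval_eq_zero {q : ℕ} {A : Set (Fin q → ℝ)}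
    (hA : volume A = 0) :
    volume {s : Fin q → unitInterval | (fun j => (s j : ℝ)) ∈ A} = 0 := by
  have h := measurePreserving_pi (fun _ : Fin q => (volume : Measure unitInterval))
    (fun _ => volume.restrict unitInterval) (fun _ => unitInterval.measurePreserving_coe)
  refine h.quasiMeasurePreserving.preimage_null ?_
  rw [← Measure.restrict_pi_pi]
  exact Measure.restrict_le_self.absolutelyContinuous hA

theorem cubeMeasure_preimage_eq_zero [MeasurableSpace Y] [BorelSpace Y]
    (he : Summable fun i => ‖e i‖) {B : Set Y} (hBm : MeasurableSet B) (hB : IsNullAlong e B) :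
    cubeMeasure (cubeSeries e ⁻¹' B) = 0 := by
  obtain ⟨q, σ, hσ, h⟩ := hB
  have hm : MeasurableSet (cubeSeries e ⁻¹' B) := (continuous_cubeSeries he).measurable hBm
  rw [← map_extend_cubeMeasure hσ, Measure.map_apply (measurable_extend σ) hm]
  refine Measure.measure_prod_null_of_ae_null (measurable_extend σ hm) ?_
  refine Eventually.of_forall fun ω => ?_
  have h1 := volume_preimage_coe_unitInterval_eq_zero (h (cubeSeries e (Function.extend σ 0 ω)))
  refine measure_mono_null (fun s hs => ?_) h1
  simp only [mem_preimage] at hs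
  rw [cubeSeries_extend he hσ] at hs
  exact hs

/-- If `∑ ‖eᵢ‖ < ∞`, every countable union of Borel sets which are null along some of the `eᵢ` is
Haar-null: the law of the random series `∑ ωᵢ eᵢ` with independent uniform `ωᵢ ∈ [0, 1]` does not
charge any translate of these sets. -/
theorem isHaarNull_iUnion_of_isNullAlong [MeasurableSpace Y] [BorelSpace Y]
    (he : Summable fun i => ‖e i‖) {B : ℕ → Set Y} (hBm : ∀ n, MeasurableSet (B n))
    (hB : ∀ n, IsNullAlong e (B n)) : IsHaarNull (⋃ n, B n) := by
  have hc := continuous_cubeSeries he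
  refine ⟨_, subset_rfl, MeasurableSet.iUnion hBm, cubeMeasure.map (cubeSeries e),
    inferInstance, ?_, ⟨range (cubeSeries e), isCompact_range hc, ?_⟩, fun x => ?_⟩
  · have := Measure.isProbabilityMeasure_map (μ := cubeMeasure) hc.measurable.aemeasurable
    exact IsProbabilityMeasure.ne_zero _
  · rw [Measure.map_apply hc.measurable (isCompact_range hc).isClosed.measurableSet.compl]
    simp
  · rw [image_add_left, preimage_iUnion]
    refine measure_iUnion_null fun n => ?_
    have hm : MeasurableSet ((fun y => -x + y) ⁻¹' B n) :=
      (continuous_const.add continuous_id).measurable (hBm n)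
    rw [Measure.map_apply hc.measurable hm]
    exact cubeMeasure_preimage_eq_zero he hm ((hB n).preimage_add (-x))

end CubeSeries

/-! ### Linear algebra of surjective Fredholm families -/

/-- If the range of `L` has codimension `q` and spans the whole space together with `q` vectors,
then these vectors are linearly independent modulo this range. -/
theorem eq_zero_of_map_add_sum_eq_zero {X Z : Type*} [AddCommGroup X] [Module ℝ X]
    [AddCommGroup Z] [Module ℝ Z] {L : X →ₗ[ℝ] Z} {q : ℕ}
    (hq : Module.finrank ℝ (Z ⧸ L.range) = q) {w : Fin q → Z}
    (hsurj : ∀ z, ∃ x, ∃ t : Fin q → ℝ, L x + ∑ j, t j • w j = z) {x : X} {t : Fin q → ℝ}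
    (h : L x + ∑ j, t j • w j = 0) : t = 0 := by
  let T : (Fin q → ℝ) →ₗ[ℝ] Z ⧸ L.range := L.range.mkQ ∘ₗ Fintype.linearCombination ℝ w
  have hT : ∀ t, T t = L.range.mkQ (∑ j, t j • w j) := fun t => by
    simp [T, Fintype.linearCombination_apply]
  have hL : ∀ x, L.range.mkQ (L x) = 0 := fun x =>
    (Submodule.Quotient.mk_eq_zero _).2 (LinearMap.mem_range_self L x)
  have hTs : Function.Surjective T := by
    intro c
    obtain ⟨z, rfl⟩ := L.range.mkQ_surjective c
    obtain ⟨x, t, rfl⟩ := hsurj z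
    exact ⟨t, by rw [hT, map_add, hL, zero_add]⟩
  have : FiniteDimensional ℝ (Z ⧸ L.range) := Module.Finite.of_surjective T hTs
  have hTi : Function.Injective T :=
    (LinearMap.injective_iff_surjective_of_finrank_eq_finrank (by simp [hq])).2 hTs
  have h0 := congrArg L.range.mkQ h
  rw [map_add, hL, zero_add, map_zero, ← hT] at h0
  exact hTi (h0.trans T.map_zero.symm)

/-- If `L` has closed range of finite codimension `q` and `(x, y) ↦ L x + D y` is onto, then `q`
vectors of a given family with dense span suffice, in place of all `y`, to reach every vector. -/
theorem exists_directions {X Y Z : Type*} [NormedAddCommGroup X] [NormedSpace ℝ X]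
    [NormedAddCommGroup Y] [NormedSpace ℝ Y] [NormedAddCommGroup Z] [NormedSpace ℝ Z]
    {L : X →L[ℝ] Z} {D : Y →L[ℝ] Z} (hcl : IsClosed (L.range : Set Z))
    [FiniteDimensional ℝ (Z ⧸ L.range)] (hsurj : ∀ z, ∃ x y, L x + D y = z)
    {e : ℕ → Y} (he : Dense (Submodule.span ℝ (range e) : Set Y)) :
    ∃ σ : Fin (Module.finrank ℝ (Z ⧸ L.range)) → ℕ, Function.Injective σ ∧
      ∀ z, ∃ x, ∃ t : Fin (Module.finrank ℝ (Z ⧸ L.range)) → ℝ,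
        L x + ∑ j, t j • D (e (σ j)) = z := by
  have : IsClosed (L.range : Set Z) := hcl
  let P : Y →ₗ[ℝ] Z ⧸ L.range := L.range.mkQ ∘ₗ D.toLinearMap
  have hPc : Continuous P := L.range.continuous_mkQ.comp D.continuous
  have hPs : Function.Surjective P := by
    intro c
    obtain ⟨z, rfl⟩ := L.range.mkQ_surjective c
    obtain ⟨x, y, rfl⟩ := hsurj z
    refine ⟨y, ?_⟩
    have : L.range.mkQ (L x) = 0 :=
      (Submodule.Quotient.mk_eq_zero _).2 (LinearMap.mem_range_self _ x)
    simp only [P, LinearMap.comp_apply, map_add, this, zero_add]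
    rfl
  have hspan : Submodule.span ℝ (range (P ∘ e)) = ⊤ := by
    have h1 : Dense (Submodule.span ℝ (range (P ∘ e)) : Set (Z ⧸ L.range)) := by
      rw [range_comp, ← Submodule.map_span, Submodule.map_coe]
      exact hPs.denseRange.dense_image hPc he
    have h2 := (Submodule.closed_of_finiteDimensional
      (Submodule.span ℝ (range (P ∘ e)))).closure_eq
    rw [h1.closure_eq] at h2
    exact SetLike.coe_injective (by simpa using h2.symm)
  obtain ⟨κ, a, ha, hsp, hli⟩ := exists_linearIndependent' ℝ (P ∘ e)
  rw [hspan] at hsp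
  let b : Module.Basis κ ℝ (Z ⧸ L.range) := Module.Basis.mk hli hsp.ge
  have : Fintype κ := FiniteDimensional.fintypeBasisIndex b
  let f : Fin (Module.finrank ℝ (Z ⧸ L.range)) ≃ κ :=
    Fintype.equivOfCardEq (by rw [Fintype.card_fin, Module.finrank_eq_card_basis b])
  refine ⟨a ∘ f, ha.comp f.injective, fun z => ?_⟩
  have hz : L.range.mkQ (z - ∑ j, (b.reindex f.symm).repr (L.range.mkQ z) j • D (e (a (f j)))) =
      0 := by
    have h1 := (b.reindex f.symm).sum_repr (L.range.mkQ z)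
    rw [map_sub, map_sum, sub_eq_zero]
    refine h1.symm.trans (Finset.sum_congr rfl fun j _ => ?_)
    rw [map_smul]
    simp [b, P]
  obtain ⟨x, hx⟩ := (Submodule.Quotient.mk_eq_zero _).1 hz
  refine ⟨x, fun j => (b.reindex f.symm).repr (L.range.mkQ z) j, ?_⟩
  have hx' : L x = _ := hx
  rw [hx']
  simp

/-! ### Finite-dimensional reduction -/

section Reduction

variable {X Y Z : Type*} [NormedAddCommGroup X] [NormedSpace ℝ X]
  [NormedAddCommGroup Y] [NormedSpace ℝ Y] [NormedAddCommGroup Z] [NormedSpace ℝ Z]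
  {n q k : ℕ}

/-- Near `(x₀, y₀)`, the solutions `(x, t)` of `Φ (x, y + ℓ t) = Φ (x₀, y₀)` are parametrized by
`ν = p x` and `y`, provided that the differential of `(x, t) ↦ (Φ (x, y₀ + ℓ t), p x)` at `(x₀, 0)`
is bijective. -/
theorem exists_solution_parametrization [CompleteSpace X] [CompleteSpace Y] [CompleteSpace Z]
    (hk : k ≠ 0) {Φ : X × Y → Z} {x₀ : X} {y₀ : Y}
    (hΦ : ContDiffAt ℝ k Φ (x₀, y₀)) (p : X →L[ℝ] (Fin n → ℝ)) (ℓ : (Fin q → ℝ) →L[ℝ] Y)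
    (hbij : Function.Bijective fun v : X × (Fin q → ℝ) =>
      (fderiv ℝ Φ (x₀, y₀) (v.1, ℓ v.2), p v.1)) :
    ∃ G : (Fin n → ℝ) × Y → X × (Fin q → ℝ), ContDiffAt ℝ k G (p x₀, y₀) ∧
      G (p x₀, y₀) = (x₀, 0) ∧
      ∀ᶠ v : ((Fin n → ℝ) × Y) × (X × (Fin q → ℝ)) in 𝓝 ((p x₀, y₀), (x₀, 0)),
        (Φ (v.2.1, v.1.2 + ℓ v.2.2) = Φ (x₀, y₀) ∧ p v.2.1 = v.1.1 ↔ G v.1 = v.2) := by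
  have hk' : (k : WithTop ℕ∞) ≠ 0 := by exact_mod_cast hk
  let f : ((Fin n → ℝ) × Y) × (X × (Fin q → ℝ)) → Z × (Fin n → ℝ) :=
    fun v => (Φ (v.2.1, v.1.2 + ℓ v.2.2), p v.2.1 - v.1.1)
  let u : ((Fin n → ℝ) × Y) × (X × (Fin q → ℝ)) := ((p x₀, y₀), (x₀, 0))
  let c : ((Fin n → ℝ) × Y) × (X × (Fin q → ℝ)) → X × Y := fun v => (v.2.1, v.1.2 + ℓ v.2.2)
  have hcu : c u = (x₀, y₀) := by simp [c, u]
  have hc : ContDiff ℝ k c := by fun_prop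
  have hf : ContDiffAt ℝ k f u := by
    have hΦu : ContDiffAt ℝ k Φ (c u) := by rwa [hcu]
    refine ContDiffAt.prodMk (hΦu.comp u hc.contDiffAt) ?_
    fun_prop
  have hder : ∀ v : X × (Fin q → ℝ), (fderiv ℝ f u ∘L .inr ℝ _ _) v =
      (fderiv ℝ Φ (x₀, y₀) (v.1, ℓ v.2), p v.1) := by
    intro v
    have hlin : HasFDerivAt (fun v : X × (Fin q → ℝ) =>
        (((p x₀, y₀), v) : ((Fin n → ℝ) × Y) × (X × (Fin q → ℝ)))) (.inr ℝ _ _) (x₀, 0) :=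
      hasFDerivAt_prodMk_right _ _
    have h1 := (hf.differentiableAt hk').hasFDerivAt.comp (x₀, (0 : Fin q → ℝ)) hlin
    have h2 : HasFDerivAt (fun v : X × (Fin q → ℝ) => (v.1, y₀ + ℓ v.2))
        ((ContinuousLinearMap.fst ℝ X (Fin q → ℝ)).prod
          (ℓ ∘L ContinuousLinearMap.snd ℝ X (Fin q → ℝ))) (x₀, 0) :=
      hasFDerivAt_fst.prodMk ((ℓ.hasFDerivAt.comp _ hasFDerivAt_snd).const_add y₀)
    have h3 : HasFDerivAt Φ (fderiv ℝ Φ (x₀, y₀)) (x₀, y₀ + ℓ 0) := by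
      simpa using (hΦ.differentiableAt hk').hasFDerivAt
    have h4 : HasFDerivAt (fun v : X × (Fin q → ℝ) => p v.1 - p x₀)
        (p ∘L ContinuousLinearMap.fst ℝ X (Fin q → ℝ)) (x₀, 0) :=
      (p.hasFDerivAt.comp _ hasFDerivAt_fst).sub_const _
    have h5 := h1.unique ((h3.comp (x₀, (0 : Fin q → ℝ)) h2).prodMk h4)
    rw [h5]
    rfl
  have hinv : (fderiv ℝ f u ∘L .inr ℝ _ _).IsInvertible := by
    have hb : Function.Bijective (fderiv ℝ f u ∘L .inr ℝ _ _) := by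
      convert hbij using 1
      exact funext hder
    exact ⟨ContinuousLinearEquiv.ofBijective _ (LinearMap.ker_eq_bot.2 hb.1)
      (LinearMap.range_eq_top.2 hb.2), ContinuousLinearMap.ext fun _ => rfl⟩
  refine ⟨hf.implicitFunction hk' hinv, hf.contDiffAt_implicitFunction hk' hinv,
    hf.implicitFunction_apply_self hk' hinv, ?_⟩
  filter_upwards [hf.eventually_apply_eq_iff_implicitFunction hk' hinv] with v hv
  rw [← hv]
  simp [f, u, sub_eq_zero]

/-- Where the codimension of the range of the partial differential in `x` is exactly `q`, the
component `t` of a parametrization of the solutions has zero differential in `ν`. -/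
theorem snd_fderiv_eq_zero_of_finrank_eq {Φ : X × Y → Z} {x : X} {y : Y} {z : Z} {ν : Fin n → ℝ}
    {ℓ : (Fin q → ℝ) →L[ℝ] Y} {G : (Fin n → ℝ) × Y → X × (Fin q → ℝ)}
    (hΦ : DifferentiableAt ℝ Φ (x, y)) (hG : DifferentiableAt ℝ G (ν, y)) (hGx : G (ν, y) = (x, 0))
    (hsol : ∀ᶠ w in 𝓝 (ν, y), Φ ((G w).1, w.2 + ℓ (G w).2) = z)
    (hsurj : Function.Surjective fun v : X × (Fin q → ℝ) => fderiv ℝ Φ (x, y) (v.1, ℓ v.2))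
    (hq : Module.finrank ℝ (Z ⧸ (fderiv ℝ (fun x' => Φ (x', y)) x).range) = q) (d : Fin n → ℝ) :
    (fderiv ℝ G (ν, y) (d, 0)).2 = 0 := by
  have hpart : fderiv ℝ (fun x' => Φ (x', y)) x = fderiv ℝ Φ (x, y) ∘L .inl ℝ X Y :=
    (hΦ.hasFDerivAt.comp x (hasFDerivAt_prodMk_left x y)).fderiv
  have hsplit : ∀ (x' : X) (t : Fin q → ℝ), fderiv ℝ Φ (x, y) (x', ℓ t) =
      fderiv ℝ (fun x' => Φ (x', y)) x x' +
        ∑ j, t j • fderiv ℝ Φ (x, y) (0, ℓ (Pi.single j 1)) := by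
    intro x' t
    have h1 : ((x', ℓ t) : X × Y) = (x', 0) + ∑ j, t j • ((0, ℓ (Pi.single j 1)) : X × Y) := by
      conv_lhs => rw [pi_eq_sum_univ' t]
      ext <;> simp [Prod.fst_sum, Prod.snd_sum, map_sum]
    rw [h1, map_add, map_sum, hpart]
    simp only [map_smul]
    rfl
  have hG' := hG.hasFDerivAt
  have hcurve : HasFDerivAt (fun w : (Fin n → ℝ) × Y => ((G w).1, w.2 + ℓ (G w).2))
      ((ContinuousLinearMap.fst ℝ X (Fin q → ℝ) ∘L fderiv ℝ G (ν, y)).prod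
        (ContinuousLinearMap.snd ℝ (Fin n → ℝ) Y +
          ℓ ∘L ContinuousLinearMap.snd ℝ X (Fin q → ℝ) ∘L fderiv ℝ G (ν, y))) (ν, y) :=
    hG'.fst.prodMk (hasFDerivAt_snd.add (ℓ.hasFDerivAt.comp _ hG'.snd))
  have hΦ' : HasFDerivAt Φ (fderiv ℝ Φ (x, y)) ((G (ν, y)).1, y + ℓ (G (ν, y)).2) := by
    simpa [hGx] using hΦ.hasFDerivAt
  have hzero := (hΦ'.comp (ν, y) hcurve).unique
    ((hasFDerivAt_const z (ν, y)).congr_of_eventuallyEq hsol)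
  have h0 := DFunLike.congr_fun hzero (d, 0)
  have h1 : fderiv ℝ Φ (x, y) ((fderiv ℝ G (ν, y) (d, 0)).1, ℓ (fderiv ℝ G (ν, y) (d, 0)).2) =
      0 := by simpa using h0
  rw [hsplit] at h1
  refine eq_zero_of_map_add_sum_eq_zero (L := (fderiv ℝ (fun x' => Φ (x', y)) x).toLinearMap) hq
    (fun z => ?_) h1
  obtain ⟨v, hv⟩ := hsurj z
  exact ⟨v.1, v.2, (hsplit v.1 v.2).symm.trans hv⟩

/-- Let `G` parametrize by `(ν, y)` the solutions `(x, t)` of `Φ (x, y + ℓ t) = z`, `p x = ν`. The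
set of the parameters `y` close to `y₀` for which `t` vanishes at some `ν` together with its
differential in `ν` is closed, and null in the directions of `ℓ`: its trace on `y + range ℓ`
consists, up to translation, of critical values of `ν ↦ (G (ν, y)).2` of rank zero. -/
theorem exists_isClosed_null_of_parametrization (hk : 0 < k) (hq : 0 < q) (hn : n ≤ k * q)
    {Z : Type*} {Φ : X × Y → Z} {x₀ : X} {y₀ : Y} {ν₀ : Fin n → ℝ} {z : Z} {p : X →L[ℝ] (Fin n → ℝ)}
    {ℓ : (Fin q → ℝ) →L[ℝ] Y} {G : (Fin n → ℝ) × Y → X × (Fin q → ℝ)}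
    (hG : ContDiffAt ℝ k G (ν₀, y₀)) (hG₀ : G (ν₀, y₀) = (x₀, 0))
    (hiff : ∀ᶠ v : ((Fin n → ℝ) × Y) × (X × (Fin q → ℝ)) in 𝓝 ((ν₀, y₀), (x₀, 0)),
        (Φ (v.2.1, v.1.2 + ℓ v.2.2) = z ∧ p v.2.1 = v.1.1 ↔ G v.1 = v.2)) :
    ∃ B : Set Y, IsClosed B ∧ (∀ y, volume {t : Fin q → ℝ | y + ℓ t ∈ B} = 0) ∧
      ∀ᶠ w in 𝓝 (ν₀, y₀), (G w).2 = 0 → (∀ d, (fderiv ℝ G w (d, 0)).2 = 0) → w.2 ∈ B := by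
  have hk' : (k : WithTop ℕ∞) ≠ 0 := by exact_mod_cast hk.ne'
  obtain ⟨δ, hδ, hiff⟩ := Metric.eventually_nhds_iff_ball.1 hiff
  have hGt : Tendsto G (𝓝 (ν₀, y₀)) (𝓝 (x₀, 0)) := hG₀ ▸ hG.continuousAt.tendsto
  obtain ⟨r, hr, hball⟩ := Metric.eventually_nhds_iff_ball.1
    ((hG.eventually (by simp)).and ((hGt.eventually (Metric.ball_mem_nhds _ (half_pos hδ))).and
      (Metric.ball_mem_nhds (ν₀, y₀) hδ)))
  obtain ⟨r', hr', hr'r⟩ : ∃ r', 0 < r' ∧ r' < r := exists_between hr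
  have hmem : ∀ {ν y}, ν ∈ Metric.ball ν₀ r → y ∈ Metric.closedBall y₀ r' →
      (ν, y) ∈ Metric.ball (ν₀, y₀) r := fun hν hy => by
    rw [Metric.mem_ball, Prod.dist_eq]
    exact max_lt hν ((Metric.mem_closedBall.1 hy).trans_lt hr'r)
  have hsub : Metric.closedBall ν₀ r' ⊆ Metric.ball ν₀ r := Metric.closedBall_subset_ball hr'r
  let D : (Fin n → ℝ) × Y → (Fin n → ℝ) →L[ℝ] (Fin q → ℝ) := fun w =>
    ContinuousLinearMap.snd ℝ X (Fin q → ℝ) ∘L (fderiv ℝ G w ∘L .inl ℝ (Fin n → ℝ) Y)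
  have hD : ∀ w, D w = 0 ↔ ∀ d, (fderiv ℝ G w (d, 0)).2 = 0 := fun w =>
    DFunLike.ext_iff
  let K : Set ((Fin n → ℝ) × Y) := {w ∈ Metric.closedBall ν₀ r' ×ˢ Metric.closedBall y₀ r' |
    ((G w).2, D w) = 0}
  have hKc : IsClosed K := by
    refine ContinuousOn.preimage_isClosed_of_isClosed (f := fun w => ((G w).2, D w)) ?_
      (Metric.isClosed_closedBall.prod Metric.isClosed_closedBall) isClosed_singleton
    intro w hw
    have hGw := (hball w (hmem (hsub hw.1) hw.2)).1
    refine ContinuousAt.continuousWithinAt (ContinuousAt.prodMk hGw.continuousAt.snd ?_)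
    have := hGw.continuousAt_fderiv hk'
    fun_prop
  refine ⟨Prod.snd '' K, ?_, fun y => ?_, ?_⟩
  · -- projecting along a compact ball is a closed map
    have hcomp := isCompact_iff_compactSpace.1 (isCompact_closedBall ν₀ r')
    have h1 : IsClosed {w : Metric.closedBall ν₀ r' × Y | ((w.1 : Fin n → ℝ), w.2) ∈ K} :=
      hKc.preimage (by fun_prop)
    convert isClosedMap_snd_of_compactSpace _ h1 using 1
    ext y
    constructor
    · rintro ⟨⟨ν, y⟩, hK, rfl⟩
      exact ⟨(⟨ν, hK.1.1⟩, y), hK, rfl⟩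
    · rintro ⟨⟨ν, y⟩, hK, rfl⟩
      exact ⟨(ν, y), hK, rfl⟩
  · refine measure_null_of_locally_null _ fun t₁ ht₁ => ?_
    obtain ⟨⟨ν₁, y₁⟩, hK₁, hy₁ : y₁ = y + ℓ t₁⟩ := ht₁
    let g : (Fin n → ℝ) → (Fin q → ℝ) := fun ν => (G (ν, y₁)).2
    have hnull : volume (g '' {ν | ContDiffAt ℝ k g ν ∧ fderiv ℝ g ν = 0}) = 0 :=
      volume_image_eq_zero_of_fderiv_eq_zero hk hq hn fun ν hν => hν
    refine ⟨{t | y + ℓ t ∈ Prod.snd '' K} ∩ Metric.ball t₁ (δ / 2),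
      inter_mem self_mem_nhdsWithin
        (mem_nhdsWithin_of_mem_nhds (Metric.ball_mem_nhds _ (half_pos hδ))), ?_⟩
    refine measure_mono_null ?_ ((measure_preimage_add_right volume (-t₁) _).trans hnull)
    rintro t ⟨⟨⟨ν, y₂⟩, hK, hy₂ : y₂ = y + ℓ t⟩, htball⟩
    have hy₂₁ : y₂ = y₁ + ℓ (t + -t₁) := by rw [hy₂, hy₁, map_add, map_neg]; abel
    have hadd : ∀ s, y₁ + ℓ (s + (t + -t₁)) = y₂ + ℓ s := fun s => by
      rw [hy₂₁, map_add ℓ s]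
      abel
    -- a solution `(x, s)` over `y₂` is a solution `(x, s + (t - t₁))` over `y₁`: use uniqueness
    have hshift : ∀ ν' ∈ Metric.ball ν₀ r, g ν' = (G (ν', y₂)).2 + (t + -t₁) := by
      intro ν' hν'
      obtain ⟨-, h2, h3⟩ := hball (ν', y₂) (hmem hν' hK.1.2)
      obtain ⟨-, -, h4⟩ := hball (ν', y₁) (hmem hν' hK₁.1.2)
      rw [Prod.dist_eq, max_lt_iff] at h2
      have h5 : dist ((G (ν', y₂)).2 + (t + -t₁)) 0 < δ := by
        rw [dist_zero_right]
        refine (norm_add_le _ _).trans_lt ?_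
        have h6 := h2.2
        rw [dist_zero_right] at h6
        rw [Metric.mem_ball, dist_eq_norm, sub_eq_add_neg] at htball
        linarith
      have h6 := (hiff ((ν', y₂), G (ν', y₂)) (by
        rw [Metric.mem_ball, Prod.dist_eq, Prod.dist_eq (x := G (ν', y₂))]
        exact max_lt h3 (max_lt (h2.1.trans (half_lt_self hδ)) (h2.2.trans (half_lt_self hδ))))).2
        rfl
      have h7 := (hiff ((ν', y₁), ((G (ν', y₂)).1, (G (ν', y₂)).2 + (t + -t₁))) (by
        rw [Metric.mem_ball, Prod.dist_eq, Prod.dist_eq (y := (x₀, (0 : Fin q → ℝ)))]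
        exact max_lt h4 (max_lt (h2.1.trans (half_lt_self hδ)) h5))).1 ⟨by
          rw [← h6.1]
          exact congrArg (fun y => Φ (_, y)) (hadd _), h6.2⟩
      exact congrArg Prod.snd h7
    have hKt := Prod.mk_eq_zero.1 hK.2
    refine ⟨ν, ⟨?_, ?_⟩, ?_⟩
    · have h1 := (hball _ (hmem (hsub hK.1.1) hK₁.1.2)).1
      exact (h1.comp ν (contDiffAt_id.prodMk contDiffAt_const)).snd
    · have h1 := ((hball _ (hmem (hsub hK.1.1) hK.1.2)).1.differentiableAt hk').hasFDerivAt
      have h2 : HasFDerivAt (fun ν' => G (ν', y₂)) (fderiv ℝ G (ν, y₂) ∘L .inl ℝ _ _) ν :=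
        h1.comp ν (hasFDerivAt_prodMk_left ν y₂)
      have h2 : HasFDerivAt (fun ν' => (G (ν', y₂)).2 + (t + -t₁)) (D (ν, y₂)) ν :=
        h2.snd.add_const _
      rw [← hKt.2, ← h2.fderiv]
      exact Filter.EventuallyEq.fderiv_eq
        (eventually_of_mem (Metric.isOpen_ball.mem_nhds (hsub hK.1.1)) hshift)
    · rw [hshift ν (hsub hK.1.1), hKt.1, zero_add]
  · have h1 : Metric.closedBall ν₀ r' ×ˢ Metric.closedBall y₀ r' ∈ 𝓝 (ν₀, y₀) :=
      prod_mem_nhds (Metric.closedBall_mem_nhds _ hr') (Metric.closedBall_mem_nhds _ hr')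
    filter_upwards [h1] with w hw h2 h3
    exact ⟨w, ⟨hw, Prod.mk_eq_zero.2 ⟨h2, (hD w).2 h3⟩⟩, rfl⟩

/-- The local form of the theorem. Near a solution `(x₀, y₀)` at which the partial differential has
range of codimension `q > 0`, the parameters `y` of the solutions with the same codimension lie in
a closed set which is null along finitely many of the `e i`. -/
theorem exists_isClosed_isNullAlong_near [CompleteSpace X] [CompleteSpace Y] [CompleteSpace Z]
    (hk : k ≠ 0) {Φ : X × Y → Z} {x₀ : X} {y₀ : Y} (hΦ : ContDiffAt ℝ k Φ (x₀, y₀))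
    (hfred : (fderiv ℝ (fun x => Φ (x, y₀)) x₀).IsFredholm)
    (hindex : fredholmIndex (fderiv ℝ (fun x => Φ (x, y₀)) x₀) < k)
    (hsurj : Function.Surjective (fderiv ℝ Φ (x₀, y₀)))
    (hcrit : ¬ Function.Surjective (fderiv ℝ (fun x => Φ (x, y₀)) x₀))
    {e : ℕ → Y} (he : Dense (Submodule.span ℝ (range e) : Set Y)) :
    ∃ B : Set Y, IsClosed B ∧ IsNullAlong e B ∧ ∀ᶠ w in 𝓝 (x₀, y₀), Φ w = Φ (x₀, y₀) →
      Module.finrank ℝ (Z ⧸ (fderiv ℝ (fun x => Φ (x, w.2)) w.1).range) =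
        Module.finrank ℝ (Z ⧸ (fderiv ℝ (fun x => Φ (x, y₀)) x₀).range) → w.2 ∈ B := by
  have hk' : (k : WithTop ℕ∞) ≠ 0 := by exact_mod_cast hk
  have hpart : fderiv ℝ (fun x => Φ (x, y₀)) x₀ = fderiv ℝ Φ (x₀, y₀) ∘L .inl ℝ X Y :=
    ((hΦ.differentiableAt hk').hasFDerivAt.comp x₀ (hasFDerivAt_prodMk_left x₀ y₀)).fderiv
  set L := fderiv ℝ (fun x => Φ (x, y₀)) x₀
  set q := Module.finrank ℝ (Z ⧸ L.range)
  set n := Module.finrank ℝ L.ker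
  have hker : FiniteDimensional ℝ L.ker := hfred.finite_ker
  have hcoker : FiniteDimensional ℝ (Z ⧸ L.range) := hfred.finite_coker
  have hq : 0 < q := by
    rw [Nat.pos_iff_ne_zero]
    intro h0
    have hsub : Subsingleton (Z ⧸ L.range) := Module.finrank_zero_iff.1 h0
    exact hcrit (LinearMap.range_eq_top.1 (Submodule.Quotient.subsingleton_iff.1 hsub))
  have hn : n ≤ k * q := by
    -- `n ≤ k + q - 1`, and `(k - 1) * (q - 1) ≥ 0`
    have h1 : n < k + q := by
      have : (n : ℤ) - q < k := hindex
      omega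
    nlinarith [Nat.pos_of_ne_zero hk]
  obtain ⟨σ, hσ, hdir⟩ := exists_directions (L := L) (D := fderiv ℝ Φ (x₀, y₀) ∘L .inr ℝ X Y)
    hfred.isClosed_range (fun z => by
      obtain ⟨v, rfl⟩ := hsurj z
      refine ⟨v.1, v.2, ?_⟩
      rw [hpart, ContinuousLinearMap.comp_inl_add_comp_inr]) he
  let ℓ : (Fin q → ℝ) →L[ℝ] Y :=
    (Fintype.linearCombination ℝ fun j => e (σ j)).toContinuousLinearMap
  have hℓ : ∀ t, ℓ t = ∑ j, t j • e (σ j) := fun t =>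
    Fintype.linearCombination_apply ..
  have hsplit : ∀ v : X × (Fin q → ℝ), fderiv ℝ Φ (x₀, y₀) (v.1, ℓ v.2) =
      L v.1 + ∑ j, v.2 j • (fderiv ℝ Φ (x₀, y₀) ∘L .inr ℝ X Y) (e (σ j)) := by
    intro v
    rw [← ContinuousLinearMap.comp_inl_add_comp_inr, ← hpart, hℓ, map_sum]
    simp only [map_smul]
  -- the kernel component of `x`, read in `ℝⁿ`
  obtain ⟨π, hπ⟩ := hfred.closedComplemented_ker
  let E : L.ker ≃L[ℝ] (Fin n → ℝ) := ContinuousLinearEquiv.ofFinrankEq (by simp [n])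
  let p : X →L[ℝ] (Fin n → ℝ) := E.toContinuousLinearMap ∘L π
  have hp : ∀ v : L.ker, p v = E v := fun v => congrArg E (hπ v)
  have hbij : Function.Bijective fun v : X × (Fin q → ℝ) =>
      (fderiv ℝ Φ (x₀, y₀) (v.1, ℓ v.2), p v.1) := by
    have hinj : ∀ v : X × (Fin q → ℝ), fderiv ℝ Φ (x₀, y₀) (v.1, ℓ v.2) = 0 → p v.1 = 0 →
        v = 0 := by
      rintro ⟨x, t⟩ h1 h2
      rw [hsplit] at h1
      have ht : t = 0 := eq_zero_of_map_add_sum_eq_zero (L := L.toLinearMap) rfl hdir h1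
      have hx : L x = 0 := by simpa [ht] using h1
      have hx0 := hp ⟨x, hx⟩
      rw [h2, eq_comm, E.map_eq_zero_iff] at hx0
      exact Prod.mk_eq_zero.2 ⟨congrArg Subtype.val hx0, ht⟩
    constructor
    · intro v w h
      obtain ⟨h1, h2⟩ := Prod.mk.inj h
      refine sub_eq_zero.1 (hinj (v - w) ?_ ?_)
      · rw [← sub_eq_zero.2 h1, ← map_sub]
        simp
      · simpa [sub_eq_zero] using h2
    · rintro ⟨z, ν⟩
      obtain ⟨x, t, h⟩ := hdir z
      refine ⟨(x + E.symm (ν - p x), t), Prod.ext ?_ ?_⟩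
      · have h0 : L (E.symm (ν - p x)) = 0 := (E.symm (ν - p x)).2
        refine (hsplit (_, t)).trans ?_
        rw [map_add, h0, add_zero]
        exact h
      · simp [hp]
  obtain ⟨G, hG, hG₀, hiff⟩ := exists_solution_parametrization hk hΦ p ℓ hbij
  obtain ⟨B, hBc, hBn, hB⟩ :=
    exists_isClosed_null_of_parametrization (Nat.pos_of_ne_zero hk) hq hn hG hG₀ hiff
  refine ⟨B, hBc, ⟨q, σ, hσ, fun y => by simpa only [hℓ] using hBn y⟩, ?_⟩
  have hΦ₀ : ∀ᶠ w in 𝓝 (x₀, y₀), DifferentiableAt ℝ Φ w :=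
    (hΦ.eventually (by simp)).mono fun w hw => hw.differentiableAt hk'
  have hbij₀ : ∀ᶠ w in 𝓝 (x₀, y₀), Function.Surjective fun v : X × (Fin q → ℝ) =>
      fderiv ℝ Φ w (v.1, ℓ v.2) := by
    let S : X × Y → X × (Fin q → ℝ) →L[ℝ] Z × (Fin n → ℝ) := fun w =>
      (fderiv ℝ Φ w ∘L (ContinuousLinearMap.fst ℝ X (Fin q → ℝ)).prod
        (ℓ ∘L ContinuousLinearMap.snd ℝ X (Fin q → ℝ))).prod
          (p ∘L ContinuousLinearMap.fst ℝ X (Fin q → ℝ))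
    have hSc : ContinuousAt S (x₀, y₀) := by
      have h1 := hΦ.continuousAt_fderiv hk'
      have h2 : ContinuousAt (fun w => (fderiv ℝ Φ w ∘L
          (ContinuousLinearMap.fst ℝ X (Fin q → ℝ)).prod (ℓ ∘L ContinuousLinearMap.snd ℝ X
            (Fin q → ℝ)), p ∘L ContinuousLinearMap.fst ℝ X (Fin q → ℝ))) (x₀, y₀) := by fun_prop
      exact (ContinuousLinearMap.prodₗᵢ ℝ).continuous.continuousAt.comp h2
    let S₀ : (X × (Fin q → ℝ)) ≃L[ℝ] Z × (Fin n → ℝ) := ContinuousLinearEquiv.ofBijective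
      (S (x₀, y₀)) (LinearMap.ker_eq_bot.2 hbij.1) (LinearMap.range_eq_top.2 hbij.2)
    have hS₀ : S (x₀, y₀) = S₀ := ContinuousLinearMap.ext fun _ => rfl
    have hnhds : range ((↑) : ((X × (Fin q → ℝ)) ≃L[ℝ] Z × (Fin n → ℝ)) → _) ∈
        𝓝 (S (x₀, y₀)) := hS₀ ▸ S₀.nhds
    filter_upwards [hSc hnhds] with w hw z
    obtain ⟨S', hS'⟩ := hw
    obtain ⟨v, hv⟩ := S'.surjective (z, 0)
    have h1 : S w v = (z, 0) := by rw [← hS']; exact hv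
    exact ⟨v, congrArg Prod.fst h1⟩
  have hGt : Tendsto G (𝓝 (p x₀, y₀)) (𝓝 (x₀, 0)) := hG₀ ▸ hG.continuousAt.tendsto
  have hsol : ∀ᶠ w in 𝓝 (p x₀, y₀), Φ ((G w).1, w.2 + ℓ (G w).2) = Φ (x₀, y₀) :=
    ((tendsto_id.prodMk_nhds hGt).eventually hiff).mono fun w hw => (hw.2 rfl).1
  have hGd : ∀ᶠ w in 𝓝 (p x₀, y₀), DifferentiableAt ℝ G w :=
    (hG.eventually (by simp)).mono fun w hw => hw.differentiableAt hk'
  have hproj : Tendsto (fun w : X × Y => (p w.1, w.2)) (𝓝 (x₀, y₀)) (𝓝 (p x₀, y₀)) :=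
    Continuous.tendsto (by fun_prop) _
  have hincl : Tendsto (fun w : X × Y => ((p w.1, w.2), (w.1, (0 : Fin q → ℝ)))) (𝓝 (x₀, y₀))
      (𝓝 ((p x₀, y₀), (x₀, 0))) := Continuous.tendsto (by fun_prop) _
  filter_upwards [hΦ₀, hbij₀, hincl.eventually hiff,
    hproj.eventually (hB.and (hGd.and hsol.eventually_nhds))] with ⟨x, y⟩ h1 h2 h3 h4 hz hqw
  have hGx : G (p x, y) = (x, 0) := h3.1 ⟨by simpa using hz, rfl⟩
  exact h4.1 (congrArg Prod.snd hGx)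
    (snd_fderiv_eq_zero_of_finrank_eq h1 h4.2.1 hGx h4.2.2 h2 hqw)

end Reduction

/-! ### Critical parameters -/

/-- The parameters `y` for which `z` is not a regular value lie in a countable union of closed sets
which are null along finitely many of the `e i`. -/
theorem exists_countable_cover_of_critical_parameters {X Y Z : Type*}
    [NormedAddCommGroup X] [NormedSpace ℝ X] [CompleteSpace X]
    [NormedAddCommGroup Y] [NormedSpace ℝ Y] [CompleteSpace Y]
    [NormedAddCommGroup Z] [NormedSpace ℝ Z] [CompleteSpace Z]
    [TopologicalSpace.SeparableSpace X] [TopologicalSpace.SeparableSpace Y]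
    {U : Set X} {V : Set Y} (hU : IsOpen U) (hV : IsOpen V) {k : ℕ} (hk : k ≠ 0)
    {Φ : X × Y → Z} (hΦ : ContDiffOn ℝ k Φ (U ×ˢ V)) {z : Z}
    (hFredholm : ∀ x ∈ U, ∀ y ∈ V, Φ (x, y) = z →
      (fderiv ℝ (fun x' => Φ (x', y)) x).IsFredholm ∧
        fredholmIndex (fderiv ℝ (fun x' => Φ (x', y)) x) < (k : ℤ))
    (hsurj : ∀ x ∈ U, ∀ y ∈ V, Φ (x, y) = z → Function.Surjective (fderiv ℝ Φ (x, y)))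
    {e : ℕ → Y} (he : Dense (Submodule.span ℝ (range e) : Set Y)) :
    ∃ B : ℕ → Set Y, (∀ i, IsClosed (B i)) ∧ (∀ i, IsNullAlong e (B i)) ∧
      ∀ y ∈ V, ¬ IsRegularValueOn (fun x => Φ (x, y)) U z → ∃ i, y ∈ B i := by
  let c : X × Y → ℕ := fun w =>
    Module.finrank ℝ (Z ⧸ (fderiv ℝ (fun x => Φ (x, w.2)) w.1).range)
  let C : Set (X × Y) := {w ∈ U ×ˢ V | Φ w = z ∧
    ¬ Function.Surjective (fderiv ℝ (fun x => Φ (x, w.2)) w.1)}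
  have hloc : ∀ w ∈ C, ∃ B : Set Y, IsClosed B ∧ IsNullAlong e B ∧
      ∀ᶠ w' in 𝓝 w, Φ w' = Φ w → c w' = c w → w'.2 ∈ B := by
    rintro ⟨x, y⟩ ⟨⟨hx, hy⟩, hz, hcrit⟩
    exact exists_isClosed_isNullAlong_near hk
      (hΦ.contDiffAt ((hU.prod hV).mem_nhds ⟨hx, hy⟩)) (hFredholm x hx y hy hz).1
      (hFredholm x hx y hy hz).2 (hsurj x hx y hy hz) hcrit he
  choose! B hBc hBn hB using hloc
  have hsc : SecondCountableTopology X := UniformSpace.secondCountable_of_separable X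
  have hsc' : SecondCountableTopology Y := UniformSpace.secondCountable_of_separable Y
  have hcov : ∀ q : ℕ, ∃ t ⊆ C ∩ c ⁻¹' {q}, t.Countable ∧
      C ∩ c ⁻¹' {q} ⊆ ⋃ w ∈ t, {w' | Φ w' = Φ w → c w' = c w → w'.2 ∈ B w} := fun q =>
    TopologicalSpace.countable_cover_nhdsWithin fun w hw => mem_nhdsWithin_of_mem_nhds (hB w hw.1)
  choose t htC htc ht using hcov
  obtain ⟨b, hb⟩ := (((countable_iUnion htc).image B).insert ∅).exists_eq_range
    (insert_nonempty _ _)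
  have hbprop : ∀ i, IsClosed (b i) ∧ IsNullAlong e (b i) := by
    intro i
    have hi : b i ∈ insert ∅ (B '' ⋃ q, t q) := hb ▸ mem_range_self i
    obtain hi | ⟨w, hw, hi⟩ := hi
    · rw [hi]
      exact ⟨isClosed_empty, IsNullAlong.empty e⟩
    · obtain ⟨q, hw⟩ := mem_iUnion.1 hw
      rw [← hi]
      exact ⟨hBc w (htC q hw).1, hBn w (htC q hw).1⟩
  refine ⟨b, fun i => (hbprop i).1, fun i => (hbprop i).2, fun y hy hcrit => ?_⟩
  simp only [IsRegularValueOn, not_forall] at hcrit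
  obtain ⟨x, hx, hz, hcrit⟩ := hcrit
  have hxy : (x, y) ∈ C ∩ c ⁻¹' {c (x, y)} := ⟨⟨⟨hx, hy⟩, hz, hcrit⟩, rfl⟩
  obtain ⟨w, hw, hwy⟩ := mem_iUnion₂.1 (ht _ hxy)
  have hwC := htC _ hw
  have hyB : y ∈ B w := hwy (hz.trans hwC.1.2.1.symm) hwC.2.symm
  have hwb : B w ∈ range b := hb ▸ Or.inr (mem_image_of_mem B (mem_iUnion.2 ⟨_, hw⟩))
  obtain ⟨i, hi⟩ := hwb
  exact ⟨i, hi ▸ hyB⟩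

theorem theorem3
    {X Y Z : Type*}
    [NormedAddCommGroup X] [NormedSpace ℝ X] [CompleteSpace X]
    [NormedAddCommGroup Y] [NormedSpace ℝ Y] [CompleteSpace Y]
    [MeasurableSpace Y] [BorelSpace Y]
    [NormedAddCommGroup Z] [NormedSpace ℝ Z] [CompleteSpace Z]
    [TopologicalSpace.SeparableSpace X] [TopologicalSpace.SeparableSpace Y]
    (U : Set X) (V : Set Y) (hU : IsOpen U) (hV : IsOpen V)
    (k : ℕ) (hk : 1 ≤ k)
    (Φ : X × Y → Z) (hΦ : ContDiffOn ℝ k Φ (U ×ˢ V)) (z : Z)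
    (hFredholm : ∀ x ∈ U, ∀ y ∈ V, Φ (x, y) = z →
      (fderiv ℝ (fun x' => Φ (x', y)) x).IsFredholm ∧
        fredholmIndex (fderiv ℝ (fun x' => Φ (x', y)) x) < (k : ℤ))
    (hsurj : ∀ x ∈ U, ∀ y ∈ V, Φ (x, y) = z → Function.Surjective (fderiv ℝ Φ (x, y))) :
    IsGenericIn V {y ∈ V | IsRegularValueOn (fun x => Φ (x, y)) U z} ∧
      IsPrevalentIn V {y ∈ V | IsRegularValueOn (fun x => Φ (x, y)) U z} := by
  have hk' : k ≠ 0 := Nat.one_le_iff_ne_zero.1 hk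
  obtain ⟨e, hes, hed⟩ := exists_summable_dense_span Y
  obtain ⟨B, hBc, hBn, hB⟩ :=
    exists_countable_cover_of_critical_parameters hU hV hk' hΦ hFredholm hsurj hed
  refine ⟨⟨fun y hy => hy.1, fun i => V ∩ (B i)ᶜ, fun i => ⟨hV.inter (hBc i).isOpen_compl,
    inter_subset_left, (hBn i).dense_compl.open_subset_closure_inter hV⟩, fun y hy => ?_⟩,
    fun y hy => hy.1, ?_⟩
  · rw [mem_iInter] at hy
    refine ⟨(hy 0).1, ?_⟩
    by_contra hcrit
    obtain ⟨i, hi⟩ := hB y (hy 0).1 hcrit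
    exact (hy i).2 hi
  · obtain ⟨A, hA, h⟩ := isHaarNull_iUnion_of_isNullAlong hes (fun i => (hBc i).measurableSet) hBn
    refine ⟨A, Subset.trans (fun y hy => ?_) hA, h⟩
    exact mem_iUnion.2 (hB y hy.1 fun hreg => hy.2 ⟨hy.1, hreg⟩)
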